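/- Let $(X,\|\cdot\|)$ be a Banach space over $\mathbb K=\mathbb R$ or $\mathbb C$ with norm dual $X'$, and let $\tau$ be a Hausdorff locally convex topology on $X$, coarser than the $\|\cdot\|$-topology, such that every $\|\cdot\|$-bounded $\tau$-Cauchy sequence is $\tau$-convergent and $\|x\|=\sup\{|y(x)| : y\in(X,\tau)',\ \|y\|_{X'}\le 1\}$ for all $x\in X$. Let $\gamma$ be the mixed topology of $\|\cdot\|$ and $\tau$, i.e. the finest linear topology between $\tau$ and the $\|\cdot\|$-topology that coincides with $\tau$ on $\|\cdot\|$-bounded sets. Put $$X^\circ:=\{x'\in X' : x' \text{ is } \tau\text{-sequentially continuous on } \|\cdot\|\text{-bounded sets}\}$$ with the norm of $X'$, and assume: (1) $\{x^\circ\in X^\circ:\|x^\circ\|_{X'}\le 1\}$ is sequentially complete with respect to $\sigma(X^\circ,X)$; (2) every $\|\cdot\|_{X'}$-bounded $\sigma(X^\circ,X)$-null sequence in $X^\circ$ is $\tau$-equicontinuous on $\|\cdot\|$-bounded sets; (3) $(X,\gamma)$ is a Mazur space, i.e. a linear functional on $X$ is $\gamma$-continuous if and only if it is $\gamma$-sequentially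 continuous. Let $(T(t))_{t\ge0}$ be a $\tau$-bi-continuous semigroup on $X$: bounded linear operators with $T(0)=\mathrm{id}$ and $T(t+s)=T(t)T(s)$, such that $t\mapsto T(t)x$ is $\tau$-continuous on $[0,\infty)$ for every $x\in X$; $\|T(t)\|\le Me^{\omega t}$ for all $t\ge 0$, for some $M\ge1$, $\omega\in\mathbb R$; and $\tau\text{-}\lim_n T(t)(x_n-x)=0$ locally uniformly in $t\in[0,\infty)$ whenever $(x_n)$ is $\|\cdot\|$-bounded and $\tau$-convergent to $x$. Let $T^\circ(t)$ be the restriction of the dual operator $T(t)'$ to $X^\circ$, and let $A^\circ$ be its $\sigma(X^\circ,X)$-generator: $x^\circ\in D(A^\circ)$ and $A^\circ x^\circ=y^\circ$ if and only if $y^\circ\in X^\circ$ is the $\sigma(X^\circ,X)$-limit of $\frac1t(T^\circ(t)x^\circ-x^\circ)$ as $t\to0+$ and $\sup_{t\in(0,1]}\frac1t\|T^\circ(t)x^\circ-x^\circ\|_{X'}<\infty$. Let $$X^\bullet:=\{x^\circ\in X^\circ:\lim_{t\to0+}\|T^\circ(t)x^\circ-x^\circ\|_{X'}=0\},$$ let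 $A^\bullet$ be the part of $A^\circ$ in $X^\bullet$ (so $D(A^\bullet)=\{f\in D(A^\circ)\cap X^\bullet: A^\circ f\in X^\bullet\}$), and let ${A^\bullet}'$ be its adjoint on the norm dual ${X^\bullet}'$, with domain $$D({A^\bullet}')=\{\varphi\in {X^\bullet}' : \exists\,\psi\in{X^\bullet}'\ \forall f\in D(A^\bullet):\ \varphi(A^\bullet f)=\psi(f)\}.$$ Let $j\colon X\to{X^\bullet}'$, $\langle j(x),f\rangle:=f(x)$, and put $X_{\mathrm{cont}}:=\{x\in X:\lim_{t\to0+}\|T(t)x-x\|=0\}$ and $\mathrm{Fav}(T):=\{x\in X:\limsup_{t\to0+}\frac1t\|T(t)x-x\|<\infty\}$. Then $j$ is injective, and, identifying $X$ with $j(X)$, $\mathrm{Fav}(T)=D({A^\bullet}')\cap X_{\mathrm{cont}}=D({A^\bullet}')\cap X$; that is, $$j(\mathrm{Fav}(T))=D({A^\bullet}')\cap j(X_{\mathrm{cont}})=D({A^\bullet}')\cap j(X).$$ -/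

import Mathlib

open Filter Topology
open scoped NNReal ENNReal

namespace BiCont

/-- A topology on `X` which is *not* registered for instance search, so that the notions which refer
to the topology of the norm (continuous linear maps, dual space, operator norm) always do so. -/
def AuxTopology (X : Type*) : Type _ := TopologicalSpace X

/-- A linear subspace of a normed space `E`. The abbreviation only makes sure that the module
structure of `E` is read off its normed space structure. -/
abbrev NormedSubspace (𝕜 E : Type*) [RCLike 𝕜] [NormedAddCommGroup E] [NormedSpace 𝕜 E] :=
  Submodule 𝕜 E

/-- The topology of the norm. -/
def normTopology (X : Type*) [NormedAddCommGroup X] : AuxTopology X :=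
  inferInstanceAs (TopologicalSpace X)

/-- The topology `s` is coarser than (or equal to) the topology `t`. -/
def IsCoarser {X : Type*} (s t : AuxTopology X) : Prop :=
  ∀ U : Set X, @IsOpen X s U → @IsOpen X t U

section Triple

variable (𝕜 : Type*) {X : Type*} [RCLike 𝕜] [NormedAddCommGroup X] [NormedSpace 𝕜 X]

/-- `t` is a linear topology: addition and scalar multiplication are continuous. -/
def IsLinearTopology (t : AuxTopology X) : Prop :=
  @IsTopologicalAddGroup X t _ ∧ @ContinuousSMul 𝕜 X _ _ t

/-- The linear topologies between `τ` and the norm topology which coincide with `τ` on all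
norm-bounded sets. -/
def mixedTopologyCandidates (τ : AuxTopology X) : Set (AuxTopology X) :=
  {t | IsLinearTopology 𝕜 t ∧ IsCoarser τ t ∧ IsCoarser t (normTopology X) ∧
    ∀ B : Set X, Bornology.IsBounded B →
      TopologicalSpace.induced ((↑) : B → X) t = TopologicalSpace.induced ((↑) : B → X) τ}

/-- The mixed topology `γ(‖·‖, τ)`: the finest candidate. (In Mathlib's order of topologies, smaller
means finer.) -/
def mixedTopology (τ : AuxTopology X) : AuxTopology X :=
  sInf (α := TopologicalSpace X) (mixedTopologyCandidates 𝕜 τ)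

/-- The mixed topology is indeed a candidate, and it is finer than every other candidate. -/
theorem mixedTopology_finest (τ : AuxTopology X) (hτ : IsLinearTopology 𝕜 τ)
    (hle : IsCoarser τ (normTopology X)) :
    mixedTopology 𝕜 τ ∈ mixedTopologyCandidates 𝕜 τ ∧
      ∀ t ∈ mixedTopologyCandidates 𝕜 τ, IsCoarser t (mixedTopology 𝕜 τ) := by
  have hmem : τ ∈ mixedTopologyCandidates 𝕜 τ := ⟨hτ, fun _ h => h, hle, fun _ _ => rfl⟩
  have hfin : ∀ t ∈ mixedTopologyCandidates 𝕜 τ, IsCoarser t (mixedTopology 𝕜 τ) :=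
    fun t ht => sInf_le (α := TopologicalSpace X) ht
  refine ⟨⟨⟨?_, ?_⟩, hfin τ hmem, ?_, ?_⟩, hfin⟩
  · exact topologicalAddGroup_sInf fun t ht => ht.1.1
  · exact continuousSMul_sInf fun t ht => ht.1.2
  · exact le_sInf (α := TopologicalSpace X) fun t ht => ht.2.2.1
  · intro B hB
    refine Eq.trans (induced_sInf (s := mixedTopologyCandidates 𝕜 τ)) ?_
    apply le_antisymm
    · exact sInf_le ⟨τ, hmem, rfl⟩
    · refine le_sInf ?_
      rintro _ ⟨t, ht, rfl⟩
      exact (ht.2.2.2 B hB).ge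

/-- The space `(X, t)` is a Mazur space: the linear `t`-sequentially continuous functionals are
exactly the `t`-continuous ones. -/
def IsMazur (t : AuxTopology X) : Prop :=
  ∀ f : X →ₗ[𝕜] 𝕜, @Continuous X 𝕜 t _ f ↔ @SeqContinuous X 𝕜 t _ f

/-- `(u n)` is a Cauchy sequence for the linear topology `τ`. -/
def IsCauchySequence (τ : AuxTopology X) (u : ℕ → X) : Prop :=
  ∀ U ∈ @nhds X τ 0, ∃ N, ∀ m ≥ N, ∀ n ≥ N, u m - u n ∈ U

/-- The standing assumption on a triple `(X, ‖·‖, τ)` (completeness of `(X, ‖·‖)` is assumed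
separately by `[CompleteSpace X]`). -/
structure IsAdmissible (τ : AuxTopology X) : Prop where
  /-- `τ` is coarser than the norm topology. -/
  coarser : IsCoarser τ (normTopology X)
  /-- `τ` is Hausdorff. -/
  hausdorff : @T2Space X τ
  /-- `τ` is locally convex, i.e. generated by a family of seminorms. -/
  locallyConvex : @PolynormableSpace 𝕜 X _ _ _ τ
  /-- Every norm-bounded `τ`-Cauchy sequence is `τ`-convergent. -/
  seqComplete : ∀ u : ℕ → X, Bornology.IsBounded (Set.range u) → IsCauchySequence τ u →
    ∃ x, Tendsto u atTop (@nhds X τ x)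
  /-- The dual space `(X, τ)'` is norming. -/
  norming : ∀ x : X,
    IsLUB {r : ℝ | ∃ y : StrongDual 𝕜 X, @Continuous X 𝕜 τ _ y ∧ ‖y‖ ≤ 1 ∧ r = ‖y x‖} ‖x‖

variable {𝕜} in
theorem IsAdmissible.isLinearTopology {τ : AuxTopology X} (h : IsAdmissible 𝕜 τ) :
    IsLinearTopology 𝕜 τ := by
  have hp := @PolynormableSpace.withSeminorms 𝕜 X _ _ _ τ h.locallyConvex
  exact ⟨@WithSeminorms.topologicalAddGroup 𝕜 X _ _ _ _ τ _ hp,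
    @WithSeminorms.continuousSMul 𝕜 X _ _ _ _ τ _ hp⟩

/-- `X° ⊆ X'`: the norm-continuous functionals which are `τ`-sequentially continuous on norm-bounded
sets. It carries the norm of `X'`. -/
def circDual (τ : AuxTopology X) : NormedSubspace 𝕜 (StrongDual 𝕜 X) where
  carrier := {f | ∀ (u : ℕ → X) (x : X), Bornology.IsBounded (Set.range u) →
    Tendsto u atTop (@nhds X τ x) → Tendsto (fun n => f (u n)) atTop (𝓝 (f x))}
  add_mem' := fun hf hg u x hu hx => (hf u x hu hx).add (hg u x hu hx)
  zero_mem' := fun _ _ _ _ => tendsto_const_nhds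
  smul_mem' := fun c _ hf u x hu hx => (hf u x hu hx).const_smul c

/-- The topology `σ(X°, X)` of pointwise convergence on `X`. -/
def sigmaCirc (τ : AuxTopology X) : AuxTopology (circDual 𝕜 τ) :=
  TopologicalSpace.induced (fun (f : circDual 𝕜 τ) (x : X) => (f : StrongDual 𝕜 X) x)
    Pi.topologicalSpace

/-- The additional assumption which makes the dual semigroup bi-continuous. -/
structure IsDualAdmissible (τ : AuxTopology X) : Prop where
  /-- `X° ∩ B_{X'}` is sequentially complete with respect to `σ(X°, X)`. -/
  seqComplete_unitBall : ∀ f : ℕ → circDual 𝕜 τ, (∀ n, ‖f n‖ ≤ 1) →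
    IsCauchySequence (sigmaCirc 𝕜 τ) f →
    ∃ g : circDual 𝕜 τ, ‖g‖ ≤ 1 ∧ Tendsto f atTop (@nhds _ (sigmaCirc 𝕜 τ) g)
  /-- Norm-bounded `σ(X°, X)`-null sequences are `τ`-equicontinuous on norm-bounded sets. -/
  equicontinuous_of_null : ∀ f : ℕ → circDual 𝕜 τ, Bornology.IsBounded (Set.range f) →
    Tendsto f atTop (@nhds _ (sigmaCirc 𝕜 τ) 0) →
    ∀ B : Set X, Bornology.IsBounded B →
      @EquicontinuousOn ℕ X 𝕜 τ _ (fun n x => (f n : StrongDual 𝕜 X) x) B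

end Triple

section Semigroup

variable {𝕜 : Type*} {X : Type*} [RCLike 𝕜] [NormedAddCommGroup X] [NormedSpace 𝕜 X]

/-- `(T(t))_{t ≥ 0}` is a `τ`-bi-continuous semigroup. -/
structure IsBiContinuousSemigroup (τ : AuxTopology X) (T : ℝ≥0 → X →L[𝕜] X) : Prop where
  zero : T 0 = ContinuousLinearMap.id 𝕜 X
  add : ∀ t s, T (t + s) = (T t).comp (T s)
  /-- `τ`-strong continuity. -/
  strongCont : ∀ x, @Continuous ℝ≥0 X _ τ (fun t => T t x)
  /-- Exponential boundedness. -/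
  expBounded : ∃ M : ℝ, 1 ≤ M ∧ ∃ ω : ℝ, ∀ t : ℝ≥0, ‖T t‖ ≤ M * Real.exp (ω * t)
  /-- Local bi-equicontinuity: `T(t)(u n - x) → 0` for `τ`, uniformly in `t ∈ [0, t₀]`. -/
  locallyBiEquicontinuous : ∀ (u : ℕ → X) (x : X), Bornology.IsBounded (Set.range u) →
    Tendsto u atTop (@nhds X τ x) →
    ∀ t₀ : ℝ≥0, ∀ U ∈ @nhds X τ 0, ∀ᶠ n in atTop, ∀ t ≤ t₀, T t (u n - x) ∈ U

/-- The graph of the generator of a semigroup `T` with respect to `τ`: all pairs `(x, y)` such that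
`y` is the `τ`-limit of `(T(t)x - x)/t` as `t → 0+` and `‖T(t)x - x‖/t` is bounded on `(0,1]`.
Unbounded operators are represented by their graphs. -/
def generatorGraph (τ : AuxTopology X) (T : ℝ≥0 → X →L[𝕜] X) : Set (X × X) :=
  {p | Tendsto (fun t : ℝ≥0 => ((t : ℝ) : 𝕜)⁻¹ • (T t p.1 - p.1)) (𝓝[>] 0) (@nhds X τ p.2) ∧
    ∃ C : ℝ, ∀ t : ℝ≥0, 0 < t → t ≤ 1 → ‖T t p.1 - p.1‖ / t ≤ C}

/-- The graph of the part in the subspace `Y` of the operator with graph `G`. -/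
def partGraph (Y : NormedSubspace 𝕜 X) (G : Set (X × X)) : Set (Y × Y) :=
  {p | ((p.1 : X), (p.2 : X)) ∈ G}

/-- The domain of the adjoint of the (densely defined) operator with graph `G`. -/
def adjointDomain (G : Set (X × X)) : Set (StrongDual 𝕜 X) :=
  {φ | ∃ ψ : StrongDual 𝕜 X, ∀ p ∈ G, φ p.2 = ψ p.1}

/-- The space of norm-strong continuity of `T`. For `T` on `X` this is `X_cont`. -/
def strongContSpace (T : ℝ≥0 → X →L[𝕜] X) : NormedSubspace 𝕜 X where
  carrier := {x | Tendsto (fun t => ‖T t x - x‖) (𝓝[>] 0) (𝓝 0)}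
  add_mem' := by
    intro x y hx hy
    simp only [Set.mem_ofPred_eq, ← tendsto_zero_iff_norm_tendsto_zero] at hx hy ⊢
    have h := hx.add hy
    rw [add_zero] at h
    refine h.congr fun t => ?_
    rw [map_add]
    abel
  zero_mem' := by simp
  smul_mem' := by
    intro c x hx
    simp only [Set.mem_ofPred_eq, ← tendsto_zero_iff_norm_tendsto_zero] at hx ⊢
    have h := hx.const_smul c
    rw [smul_zero] at h
    refine h.congr fun t => ?_
    rw [map_smul, smul_sub]

/-- The Favard space of `T`. -/
def favardSpace (T : ℝ≥0 → X →L[𝕜] X) : Set X :=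
  {x | limsup (fun t : ℝ≥0 => ‖T t x - x‖ₑ / (t : ℝ≥0∞)) (𝓝[>] 0) < ⊤}

/-- The dual operators `T'(t)` leave `X°` invariant. -/
theorem comp_mem_circDual {τ : AuxTopology X} {T : ℝ≥0 → X →L[𝕜] X} (hτ : IsAdmissible 𝕜 τ)
    (hT : IsBiContinuousSemigroup τ T) (t : ℝ≥0) {f : StrongDual 𝕜 X} (hf : f ∈ circDual 𝕜 τ) :
    f.comp (T t) ∈ circDual 𝕜 τ := by
  intro u x hu hx
  refine hf (fun n => T t (u n)) (T t x) ?_ ?_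
  · have h := (T t).lipschitz.isBounded_image hu
    rwa [← Set.range_comp] at h
  · have h0 : Tendsto (fun n => T t (u n - x)) atTop (@nhds X τ 0) := fun U hU =>
      (hT.locallyBiEquicontinuous u x hu hx t U hU).mono fun n hn => hn t le_rfl
    have hg := hτ.isLinearTopology.1
    have h1 := @Tendsto.add X τ _ (@IsTopologicalAddGroup.toContinuousAdd X τ _ hg) ℕ _ _ _ _ _ h0
      (@tendsto_const_nhds X τ _ (T t x) atTop)
    simpa using h1

/-- The dual semigroup on `X°`: `T°(t) f = T'(t) f = f ∘ T(t)`. -/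
noncomputable def circSemigroup {τ : AuxTopology X} {T : ℝ≥0 → X →L[𝕜] X} (hτ : IsAdmissible 𝕜 τ)
    (hT : IsBiContinuousSemigroup τ T) (t : ℝ≥0) : circDual 𝕜 τ →L[𝕜] circDual 𝕜 τ :=
  LinearMap.mkContinuous
    { toFun := fun f => ⟨(f : StrongDual 𝕜 X).comp (T t), comp_mem_circDual hτ hT t f.2⟩
      map_add' := fun _ _ => rfl
      map_smul' := fun _ _ => rfl }
    ‖T t‖ (fun f => (ContinuousLinearMap.opNorm_comp_le (f : StrongDual 𝕜 X) (T t)).trans_eq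
      (mul_comm _ _))

/-- The graph of `A°`, the generator of `T°` with respect to `σ(X°, X)`. -/
noncomputable def circGeneratorGraph {τ : AuxTopology X} {T : ℝ≥0 → X →L[𝕜] X}
    (hτ : IsAdmissible 𝕜 τ) (hT : IsBiContinuousSemigroup τ T) :
    Set (circDual 𝕜 τ × circDual 𝕜 τ) :=
  generatorGraph (sigmaCirc 𝕜 τ) (circSemigroup hτ hT)

/-- The bi-sun dual `X^•`: the space of norm-strong continuity of `T°`. -/
noncomputable def biSunDual {τ : AuxTopology X} {T : ℝ≥0 → X →L[𝕜] X} (hτ : IsAdmissible 𝕜 τ)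
    (hT : IsBiContinuousSemigroup τ T) : NormedSubspace 𝕜 (circDual 𝕜 τ) :=
  strongContSpace (circSemigroup hτ hT)

/-- The graph of `A^•`, the part of `A°` in `X^•`. -/
noncomputable def biSunGeneratorGraph {τ : AuxTopology X} {T : ℝ≥0 → X →L[𝕜] X}
    (hτ : IsAdmissible 𝕜 τ) (hT : IsBiContinuousSemigroup τ T) :
    Set (biSunDual hτ hT × biSunDual hτ hT) :=
  partGraph (biSunDual hτ hT) (circGeneratorGraph hτ hT)

/-- The canonical map `j : X → (X^•)'`, `⟨j x, f⟩ = ⟨f, x⟩`. -/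
noncomputable def canonicalMap {τ : AuxTopology X} {T : ℝ≥0 → X →L[𝕜] X} (hτ : IsAdmissible 𝕜 τ)
    (hT : IsBiContinuousSemigroup τ T) (x : X) : StrongDual 𝕜 (biSunDual hτ hT) :=
  (NormedSpace.inclusionInDoubleDual 𝕜 X x).comp
    ((circDual 𝕜 τ).subtypeL.comp (biSunDual hτ hT).subtypeL)

end Semigroup

end BiCont

/-!
The argument is the one for strongly continuous semigroups and their sun duals, carried by the
weak integrals `g_t = ∫₀ᵗ T°(s) f ds` (`circIntegral`) of an element `f` of `X°`. Such an integral
is taken pointwise on `X`; it belongs to `X°` by dominated convergence. Splitting the interval of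
integration gives the cocycle identity `g_{t+r} = g_r + T°(r) g_t` (`circIntegral_add`), and
exchanging `t` and `r` in it shows `T°(r) g_t - g_t = T°(t) g_r - g_r`. As `‖g_r‖ = O(r)` and
`r⁻¹ g_r → f` pointwise, this yields `g_t ∈ X^•` and `A° g_t = T°(t) f - f`.

Since `t⁻¹ g_t` is bounded by a multiple of `‖f‖` and converges pointwise to `f`, and since `X°`
norms `X`, the space `X^•` norms `X` up to a constant (`exists_norm_le_of_biSunDual`). Hence `j`
is injective.

If `j x` is in the domain of the adjoint of `A^•`, with `ψ` as its image, then for `f ∈ X^•` one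
has `f (T(t) x - x) = (A^• g_t)(x) = ψ (g_t) = O(t ‖f‖)`, so that `‖T(t) x - x‖ = O(t)` by the
norming property. Conversely, if `x` is in the Favard space, then the difference quotients
`t⁻¹ (T(t) x - x)` are bounded, so that their images under `j` have a weak-* cluster point `ψ` by
the Banach–Alaoglu theorem, and `(A^• f)(x) = ψ f` for all `f` in the domain of `A^•`.
-/

namespace BiCont

variable {𝕜 X : Type*} [RCLike 𝕜] [NormedAddCommGroup X] [NormedSpace 𝕜 X]
  {τ : AuxTopology X} {T : ℝ≥0 → X →L[𝕜] X}

/-! ### Weak continuity of orbits -/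

theorem tendsto_sigmaCirc_iff {ι : Type*} {l : Filter ι} {u : ι → circDual 𝕜 τ}
    {g : circDual 𝕜 τ} :
    Tendsto u l (@nhds _ (sigmaCirc 𝕜 τ) g) ↔
      ∀ x : X, Tendsto (fun i => (u i : StrongDual 𝕜 X) x) l (𝓝 ((g : StrongDual 𝕜 X) x)) := by
  rw [sigmaCirc, nhds_induced, tendsto_comap_iff, tendsto_pi_nhds]
  rfl

theorem IsBiContinuousSemigroup.exists_norm_le (hT : IsBiContinuousSemigroup τ T) (a : ℝ≥0) :
    ∃ K : ℝ, 0 ≤ K ∧ ∀ t ≤ a, ‖T t‖ ≤ K := by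
  obtain ⟨M, hM, ω, h⟩ := hT.expBounded
  refine ⟨M * Real.exp (|ω| * a), by positivity, fun t ht => (h t).trans ?_⟩
  gcongr
  · exact le_abs_self ω

/-- Orbits of `T` are weakly continuous with respect to `X°`: on a convergent sequence of times an
orbit is norm-bounded and `τ`-convergent. -/
theorem IsBiContinuousSemigroup.continuous_orbit (hT : IsBiContinuousSemigroup τ T)
    (f : circDual 𝕜 τ) (x : X) : Continuous fun t : ℝ≥0 => (f : StrongDual 𝕜 X) (T t x) := by
  refine continuous_iff_seqContinuous.2 fun u t hu => f.2 (fun n => T (u n) x) (T t x) ?_ ?_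
  · obtain ⟨a, ha⟩ := hu.bddAbove_range
    obtain ⟨K, -, hK⟩ := hT.exists_norm_le a
    refine isBounded_iff_forall_norm_le.2 ⟨K * ‖x‖, ?_⟩
    rintro _ ⟨n, rfl⟩
    exact (T (u n)).le_of_opNorm_le (hK _ (ha ⟨n, rfl⟩)) x
  · exact (@Continuous.tendsto _ _ _ τ _ (hT.strongCont x) t).comp hu

theorem IsBiContinuousSemigroup.continuous_orbit_toNNReal (hT : IsBiContinuousSemigroup τ T)
    (f : circDual 𝕜 τ) (x : X) :
    Continuous fun s : ℝ => (f : StrongDual 𝕜 X) (T s.toNNReal x) :=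
  (hT.continuous_orbit f x).comp continuous_real_toNNReal

theorem norm_apply_orbit_le {K : ℝ} {t : ℝ≥0} (hK : ∀ s ≤ t, ‖T s‖ ≤ K) (f : circDual 𝕜 τ) (x : X)
    {s : ℝ} (hs : s ∈ Set.uIoc 0 (t : ℝ)) :
    ‖(f : StrongDual 𝕜 X) (T s.toNNReal x)‖ ≤ ‖f‖ * (K * ‖x‖) := by
  rw [Set.uIoc_of_le t.coe_nonneg] at hs
  refine (f : StrongDual 𝕜 X).le_opNorm_of_le ((T _).le_of_opNorm_le (hK _ ?_) x)
  exact Real.toNNReal_le_iff_le_coe.2 hs.2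

theorem norm_integral_orbit_le {K : ℝ} {t : ℝ≥0} (hK : ∀ s ≤ t, ‖T s‖ ≤ K) (f : circDual 𝕜 τ)
    (x : X) :
    ‖∫ s in (0 : ℝ)..t, (f : StrongDual 𝕜 X) (T s.toNNReal x)‖ ≤ K * t * ‖f‖ * ‖x‖ := by
  refine (intervalIntegral.norm_integral_le_of_norm_le_const
    fun s hs => norm_apply_orbit_le hK f x hs).trans_eq ?_
  rw [sub_zero, abs_of_nonneg t.coe_nonneg]
  ring

/-! ### Weak integrals of the dual semigroup -/

/-- The weak integral `∫₀ᵗ T°(s) f ds` as an element of `X°`, that is, the functional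
`x ↦ ∫₀ᵗ f (T(s) x) ds`. -/
noncomputable def circIntegral (hτ : IsAdmissible 𝕜 τ) (hT : IsBiContinuousSemigroup τ T)
    (f : circDual 𝕜 τ) (t : ℝ≥0) : circDual 𝕜 τ :=
  ⟨LinearMap.mkContinuousOfExistsBound
    { toFun := fun x => ∫ s in (0 : ℝ)..t, (f : StrongDual 𝕜 X) (T s.toNNReal x)
      map_add' := fun x y => by
        simp only [map_add]
        exact intervalIntegral.integral_add
          ((hT.continuous_orbit_toNNReal f x).intervalIntegrable _ _)
          ((hT.continuous_orbit_toNNReal f y).intervalIntegrable _ _)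
      map_smul' := fun c x => by
        simp only [map_smul, RingHom.id_apply]
        exact intervalIntegral.integral_smul c _ }
    (by
      obtain ⟨K, -, hK⟩ := hT.exists_norm_le t
      exact ⟨K * t * ‖f‖, norm_integral_orbit_le hK f⟩), by
    intro u x hu hx
    obtain ⟨K, hK0, hK⟩ := hT.exists_norm_le t
    obtain ⟨R, hR⟩ := isBounded_iff_forall_norm_le.1 hu
    refine intervalIntegral.tendsto_integral_filter_of_dominated_convergence
      (fun _ => ‖f‖ * (K * R)) ?_ ?_ intervalIntegrable_const ?_
    · exact .of_forall fun n => (hT.continuous_orbit_toNNReal f (u n)).aestronglyMeasurable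
    · refine .of_forall fun n => .of_forall fun s hs =>
        (norm_apply_orbit_le hK f (u n) hs).trans ?_
      gcongr
      exact hR _ ⟨n, rfl⟩
    · exact .of_forall fun s _ => comp_mem_circDual hτ hT s.toNNReal f.2 u x hu hx⟩

theorem circIntegral_apply (hτ : IsAdmissible 𝕜 τ) (hT : IsBiContinuousSemigroup τ T)
    (f : circDual 𝕜 τ) (t : ℝ≥0) (x : X) :
    (circIntegral hτ hT f t : StrongDual 𝕜 X) x =
      ∫ s in (0 : ℝ)..t, (f : StrongDual 𝕜 X) (T s.toNNReal x) := rfl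

theorem norm_circSemigroup_le (hτ : IsAdmissible 𝕜 τ) (hT : IsBiContinuousSemigroup τ T)
    (t : ℝ≥0) : ‖circSemigroup hτ hT t‖ ≤ ‖T t‖ :=
  LinearMap.mkContinuous_norm_le _ (norm_nonneg _) _

theorem norm_circIntegral_le (hτ : IsAdmissible 𝕜 τ) (hT : IsBiContinuousSemigroup τ T)
    (f : circDual 𝕜 τ) {K : ℝ} {t : ℝ≥0} (hK : ∀ s ≤ t, ‖T s‖ ≤ K) :
    ‖circIntegral hτ hT f t‖ ≤ K * t * ‖f‖ := by
  have hK0 : 0 ≤ K := (norm_nonneg _).trans (hK 0 zero_le)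
  exact ContinuousLinearMap.opNorm_le_bound _ (by positivity) (norm_integral_orbit_le hK f)

theorem circIntegral_add (hτ : IsAdmissible 𝕜 τ) (hT : IsBiContinuousSemigroup τ T)
    (f : circDual 𝕜 τ) (t r : ℝ≥0) :
    circIntegral hτ hT f (t + r) =
      circIntegral hτ hT f r + circSemigroup hτ hT r (circIntegral hτ hT f t) := by
  ext x
  have hc := hT.continuous_orbit_toNNReal f x
  change ∫ s in (0 : ℝ)..(t + r : ℝ≥0), (f : StrongDual 𝕜 X) (T s.toNNReal x) =
    (∫ s in (0 : ℝ)..r, (f : StrongDual 𝕜 X) (T s.toNNReal x)) +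
      ∫ s in (0 : ℝ)..t, (f : StrongDual 𝕜 X) (T s.toNNReal (T r x))
  rw [← intervalIntegral.integral_add_adjacent_intervals (hc.intervalIntegrable 0 r)
    (hc.intervalIntegrable r _)]
  congr 1
  have h := intervalIntegral.integral_comp_add_right (a := 0) (b := t)
    (fun s : ℝ => (f : StrongDual 𝕜 X) (T s.toNNReal x)) (r : ℝ)
  rw [zero_add] at h
  rw [NNReal.coe_add, ← h]
  refine intervalIntegral.integral_congr fun s hs => ?_
  rw [Set.uIcc_of_le t.coe_nonneg] at hs
  rw [Real.toNNReal_add hs.1 r.coe_nonneg, Real.toNNReal_coe, hT.add]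
  rfl

theorem circSemigroup_circIntegral_sub (hτ : IsAdmissible 𝕜 τ) (hT : IsBiContinuousSemigroup τ T)
    (f : circDual 𝕜 τ) (t r : ℝ≥0) :
    circSemigroup hτ hT r (circIntegral hτ hT f t) - circIntegral hτ hT f t =
      circSemigroup hτ hT t (circIntegral hτ hT f r) - circIntegral hτ hT f r := by
  rw [sub_eq_sub_iff_add_eq_add, add_comm, ← circIntegral_add, add_comm t r,
    add_comm _ (circIntegral hτ hT f t), ← circIntegral_add]

/-- The integral over `[0, t]` is in the Favard space of `T°`: after exchanging `t` and `r`, the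
integral over `[0, r]` is what has to be estimated. -/
theorem exists_norm_circSemigroup_circIntegral_sub_le (hτ : IsAdmissible 𝕜 τ)
    (hT : IsBiContinuousSemigroup τ T) (f : circDual 𝕜 τ) (t : ℝ≥0) :
    ∃ C : ℝ, ∀ r ≤ 1,
      ‖circSemigroup hτ hT r (circIntegral hτ hT f t) - circIntegral hτ hT f t‖ ≤ C * r := by
  obtain ⟨K, -, hK⟩ := hT.exists_norm_le 1
  refine ⟨(‖T t‖ + 1) * (K * ‖f‖), fun r hr => ?_⟩
  have hg := norm_circIntegral_le hτ hT f fun s hs => hK s (hs.trans hr)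
  rw [circSemigroup_circIntegral_sub]
  calc _ ≤ ‖T t‖ * ‖circIntegral hτ hT f r‖ + ‖circIntegral hτ hT f r‖ :=
        (norm_sub_le _ _).trans (by
          gcongr
          exact ContinuousLinearMap.le_of_opNorm_le _ (norm_circSemigroup_le hτ hT t) _)
    _ = (‖T t‖ + 1) * ‖circIntegral hτ hT f r‖ := by ring
    _ ≤ (‖T t‖ + 1) * (K * r * ‖f‖) := by gcongr
    _ = _ := by ring

/-! ### Weak integrals and the generator of the dual semigroup -/

theorem mem_strongContSpace_of_eventually_le {Y : Type*} [NormedAddCommGroup Y] [NormedSpace 𝕜 Y]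
    {S : ℝ≥0 → Y →L[𝕜] Y} {x : Y} {C : ℝ}
    (h : ∀ᶠ t in 𝓝[>] (0 : ℝ≥0), ‖S t x - x‖ ≤ C * t) : x ∈ strongContSpace S := by
  have h0 : Tendsto (fun t : ℝ≥0 => C * (t : ℝ)) (𝓝[>] 0) (𝓝 0) := by
    have : Continuous fun t : ℝ≥0 => C * (t : ℝ) := by fun_prop
    simpa using (this.tendsto 0).mono_left nhdsWithin_le_nhds
  exact squeeze_zero' (.of_forall fun _ => norm_nonneg _) h h0

theorem eventually_le_one : ∀ᶠ t in 𝓝[>] (0 : ℝ≥0), t ≤ 1 :=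
  nhdsWithin_le_nhds (Iic_mem_nhds one_pos)

theorem circIntegral_mem_biSunDual (hτ : IsAdmissible 𝕜 τ) (hT : IsBiContinuousSemigroup τ T)
    (f : circDual 𝕜 τ) (t : ℝ≥0) : circIntegral hτ hT f t ∈ biSunDual hτ hT := by
  obtain ⟨C, hC⟩ := exists_norm_circSemigroup_circIntegral_sub_le hτ hT f t
  exact mem_strongContSpace_of_eventually_le (eventually_le_one.mono hC)

theorem tendsto_inv_smul_circIntegral (hτ : IsAdmissible 𝕜 τ) (hT : IsBiContinuousSemigroup τ T)
    (f : circDual 𝕜 τ) (x : X) :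
    Tendsto (fun t : ℝ≥0 => ((t : ℝ) : 𝕜)⁻¹ • (circIntegral hτ hT f t : StrongDual 𝕜 X) x) (𝓝[>] 0)
      (𝓝 ((f : StrongDual 𝕜 X) x)) := by
  have hc := hT.continuous_orbit_toNNReal f x
  have hd := hasDerivAt_iff_tendsto_slope_zero.1 (intervalIntegral.integral_hasDerivAt_right
    (hc.intervalIntegrable 0 0) hc.stronglyMeasurable.stronglyMeasurableAtFilter hc.continuousAt)
  have hcoe : Tendsto ((↑) : ℝ≥0 → ℝ) (𝓝[>] 0) (𝓝[≠] 0) := by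
    refine tendsto_nhdsWithin_iff.2 ⟨?_, ?_⟩
    · exact (NNReal.continuous_coe.tendsto 0).mono_left nhdsWithin_le_nhds
    · filter_upwards [self_mem_nhdsWithin] with t ht
      exact NNReal.coe_ne_zero.2 (ne_of_gt ht)
  have h := hd.comp hcoe
  simp only [Real.toNNReal_zero, hT.zero, ContinuousLinearMap.id_apply] at h
  refine h.congr fun t => ?_
  simp [circIntegral_apply, RCLike.real_smul_eq_coe_mul]

theorem circSemigroup_mem_biSunDual (hτ : IsAdmissible 𝕜 τ) (hT : IsBiContinuousSemigroup τ T)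
    {f : circDual 𝕜 τ} (hf : f ∈ biSunDual hτ hT) (t : ℝ≥0) :
    circSemigroup hτ hT t f ∈ biSunDual hτ hT := by
  have hcomm (r : ℝ≥0) : circSemigroup hτ hT r (circSemigroup hτ hT t f) =
      circSemigroup hτ hT t (circSemigroup hτ hT r f) := by
    ext x
    change (f : StrongDual 𝕜 X) (((T t).comp (T r)) x) = (f : StrongDual 𝕜 X) (((T r).comp (T t)) x)
    rw [← hT.add, ← hT.add, add_comm]
  have hf' : Tendsto (fun r => ‖circSemigroup hτ hT r f - f‖) (𝓝[>] 0) (𝓝 0) := hf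
  refine squeeze_zero (fun _ => norm_nonneg _) (fun r => ?_)
    (by simpa using hf'.const_mul ‖circSemigroup hτ hT t‖)
  rw [hcomm, ← map_sub]
  exact ContinuousLinearMap.le_opNorm _ _

/-- `∫₀ᵗ T°(s) f ds` is in the domain of `A°`, which maps it to `T°(t) f - f`. -/
theorem circIntegral_mem_circGeneratorGraph (hτ : IsAdmissible 𝕜 τ)
    (hT : IsBiContinuousSemigroup τ T) (f : circDual 𝕜 τ) (t : ℝ≥0) :
    (circIntegral hτ hT f t, circSemigroup hτ hT t f - f) ∈ circGeneratorGraph hτ hT := by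
  refine ⟨tendsto_sigmaCirc_iff.2 fun x => ?_, ?_⟩
  · refine ((tendsto_inv_smul_circIntegral hτ hT f (T t x)).sub
      (tendsto_inv_smul_circIntegral hτ hT f x)).congr fun r => ?_
    simp only [circSemigroup_circIntegral_sub hτ hT f t r]
    rw [← smul_sub]
    rfl
  · obtain ⟨C, hC⟩ := exists_norm_circSemigroup_circIntegral_sub_le hτ hT f t
    exact ⟨C, fun r hr hr1 => (div_le_iff₀ (NNReal.coe_pos.2 hr)).2 (hC r hr1)⟩

/-! ### The bi-sun dual norms the space -/

/-- The dual of `(X, τ)` norms `X` and is contained in `X°`. -/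
theorem IsAdmissible.norm_le_of_circDual (hτ : IsAdmissible 𝕜 τ) {y : X} {c : ℝ}
    (h : ∀ f : circDual 𝕜 τ, ‖f‖ ≤ 1 → ‖(f : StrongDual 𝕜 X) y‖ ≤ c) : ‖y‖ ≤ c := by
  refine (hτ.norming y).2 ?_
  rintro _ ⟨f, hfc, hf1, rfl⟩
  exact h ⟨f, fun u x _ hx => (@Continuous.tendsto _ _ τ _ _ hfc x).comp hx⟩ hf1

/-- The bi-sun dual norms `X` up to a constant: every `f` in `X°` is the pointwise limit of the
means `t⁻¹ ∫₀ᵗ T°(s) f ds`, which are bounded by a multiple of `‖f‖`. -/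
theorem exists_norm_le_of_biSunDual (hτ : IsAdmissible 𝕜 τ) (hT : IsBiContinuousSemigroup τ T) :
    ∃ K : ℝ, ∀ (y : X) (c : ℝ), 0 ≤ c →
      (∀ f ∈ biSunDual hτ hT, ‖(f : StrongDual 𝕜 X) y‖ ≤ c * ‖f‖) → ‖y‖ ≤ c * K := by
  obtain ⟨K, hK0, hK⟩ := hT.exists_norm_le 1
  refine ⟨K, fun y c hc h => hτ.norm_le_of_circDual fun f hf => ?_⟩
  refine le_of_tendsto (tendsto_inv_smul_circIntegral hτ hT f y).norm ?_
  filter_upwards [eventually_le_one, self_mem_nhdsWithin] with t ht ht0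
  have ht0' : (0 : ℝ) < t := NNReal.coe_pos.2 ht0
  have hg := norm_circIntegral_le hτ hT f fun s hs => hK s (hs.trans ht)
  rw [norm_smul, norm_inv, RCLike.norm_ofReal, abs_of_pos ht0', inv_mul_le_iff₀ ht0']
  calc _ ≤ c * ‖circIntegral hτ hT f t‖ := h _ (circIntegral_mem_biSunDual hτ hT f t)
    _ ≤ c * (K * t * 1) := by gcongr; exact hg.trans (by gcongr)
    _ = _ := by ring

theorem canonicalMap_apply (hτ : IsAdmissible 𝕜 τ) (hT : IsBiContinuousSemigroup τ T) (x : X)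
    (f : biSunDual hτ hT) : canonicalMap hτ hT x f = ((f : circDual 𝕜 τ) : StrongDual 𝕜 X) x := rfl

theorem canonicalMap_injective (hτ : IsAdmissible 𝕜 τ) (hT : IsBiContinuousSemigroup τ T) :
    Function.Injective (canonicalMap hτ hT) := by
  intro x y hxy
  obtain ⟨K, hK⟩ := exists_norm_le_of_biSunDual hτ hT
  have h : ‖x - y‖ ≤ 0 * K := hK _ _ le_rfl fun f hf => by
    have := DFunLike.congr_fun hxy ⟨f, hf⟩
    simp only [canonicalMap_apply] at this
    simp [this]
  rw [zero_mul] at h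
  exact sub_eq_zero.1 (norm_le_zero_iff.1 h)

/-! ### The Favard space -/

theorem mem_favardSpace_iff {x : X} :
    x ∈ favardSpace T ↔ ∃ C : ℝ≥0, ∀ᶠ t in 𝓝[>] (0 : ℝ≥0), ‖T t x - x‖ ≤ C * t := by
  have key (C t : ℝ≥0) (ht : 0 < t) :
      ‖T t x - x‖ₑ / (t : ℝ≥0∞) ≤ C ↔ ‖T t x - x‖ ≤ C * t := by
    rw [ENNReal.div_le_iff (by simpa using ht.ne') ENNReal.coe_ne_top, enorm_eq_nnnorm]
    norm_cast
  constructor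
  · intro h
    obtain ⟨C, hC, hC'⟩ := ENNReal.lt_iff_exists_nnreal_btwn.1 (show limsup _ _ < ⊤ from h)
    refine ⟨C, ?_⟩
    filter_upwards [eventually_lt_of_limsup_lt hC, self_mem_nhdsWithin] with t ht ht0
    exact (key C t ht0).1 ht.le
  · rintro ⟨C, hC⟩
    refine lt_of_le_of_lt (limsup_le_of_le (a := (C : ℝ≥0∞)) (h := ?_)) ENNReal.coe_lt_top
    filter_upwards [hC, self_mem_nhdsWithin] with t ht ht0
    exact (key C t ht0).2 ht

theorem favardSpace_subset_strongContSpace : favardSpace T ⊆ strongContSpace T := fun _ hx =>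
  (mem_favardSpace_iff.1 hx).elim fun _ hC => mem_strongContSpace_of_eventually_le hC

/-- The image of `j x` under the adjoint of `A^•` is a weak-* cluster point of the bounded
difference quotients `j (t⁻¹ (T t x - x))`. -/
theorem canonicalMap_mem_adjointDomain (hτ : IsAdmissible 𝕜 τ) (hT : IsBiContinuousSemigroup τ T)
    {x : X} (hx : x ∈ favardSpace T) :
    canonicalMap hτ hT x ∈ adjointDomain (biSunGeneratorGraph hτ hT) := by
  obtain ⟨C, hC⟩ := mem_favardSpace_iff.1 hx
  set q : ℝ≥0 → X := fun t => ((t : ℝ) : 𝕜)⁻¹ • (T t x - x) with hq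
  have hbound : ∀ᶠ t in 𝓝[>] (0 : ℝ≥0), ‖canonicalMap hτ hT (q t)‖ ≤ C := by
    filter_upwards [hC, self_mem_nhdsWithin] with t ht ht0
    have ht0' : (0 : ℝ) < t := NNReal.coe_pos.2 ht0
    have hqt : ‖q t‖ ≤ C := by
      rw [hq, norm_smul, norm_inv, RCLike.norm_ofReal, abs_of_pos ht0', inv_mul_le_iff₀ ht0',
        mul_comm]
      exact ht
    refine ContinuousLinearMap.opNorm_le_bound _ C.2 fun f => ?_
    rw [canonicalMap_apply, mul_comm]
    exact ContinuousLinearMap.le_opNorm_of_le _ hqt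
  -- A weak-* limit along an ultrafilter of times tending to zero.
  let U : Ultrafilter ℝ≥0 := Ultrafilter.of (𝓝[>] 0)
  have hU : (U : Filter ℝ≥0) ≤ 𝓝[>] 0 := Ultrafilter.of_le _
  obtain ⟨ψ, -, hψ⟩ := (WeakDual.isCompact_closedBall (𝕜 := 𝕜) (E := biSunDual hτ hT) 0 C)
    |>.ultrafilter_le_nhds' (U.map fun t => StrongDual.toWeakDual (canonicalMap hτ hT (q t)))
      (hU (hbound.mono fun t ht => mem_closedBall_zero_iff.2 ht))
  refine ⟨WeakDual.toStrongDual ψ, fun p hp => ?_⟩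
  have h1 : Tendsto (fun t => canonicalMap hτ hT (q t) p.1) U (𝓝 (WeakDual.toStrongDual ψ p.1)) :=
    (WeakDual.eval_continuous p.1).continuousAt.tendsto.comp hψ
  refine tendsto_nhds_unique ?_ h1
  refine ((tendsto_sigmaCirc_iff.1 hp.1 x).mono_left hU).congr fun t => ?_
  rw [canonicalMap_apply, hq, map_smul, map_sub]
  rfl

/-- If `ψ` is the image of `j x` under the adjoint of `A^•`, then `f (T t x - x)` is the value of
`ψ` at `∫₀ᵗ T°(s) f ds` for all `f` in `X^•`, hence is of order `t ‖f‖`. -/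
theorem mem_favardSpace_of_canonicalMap_mem (hτ : IsAdmissible 𝕜 τ)
    (hT : IsBiContinuousSemigroup τ T) {x : X}
    (hx : canonicalMap hτ hT x ∈ adjointDomain (biSunGeneratorGraph hτ hT)) :
    x ∈ favardSpace T := by
  obtain ⟨ψ, hψ⟩ := hx
  obtain ⟨K, hK0, hK⟩ := hT.exists_norm_le 1
  obtain ⟨L, hL⟩ := exists_norm_le_of_biSunDual hτ hT
  refine mem_favardSpace_iff.2 ⟨(‖ψ‖ * K * L).toNNReal, ?_⟩
  filter_upwards [eventually_le_one] with t ht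
  have h : ‖T t x - x‖ ≤ ‖ψ‖ * K * t * L := by
    refine hL _ _ (by positivity) fun f hf => ?_
    obtain ⟨G, hG⟩ : ∃ G : biSunDual hτ hT, (G : circDual 𝕜 τ) = circIntegral hτ hT f t :=
      ⟨⟨_, circIntegral_mem_biSunDual hτ hT f t⟩, rfl⟩
    obtain ⟨D, hD⟩ : ∃ D : biSunDual hτ hT, (D : circDual 𝕜 τ) = circSemigroup hτ hT t f - f :=
      ⟨⟨_, (biSunDual hτ hT).sub_mem (circSemigroup_mem_biSunDual hτ hT hf t) hf⟩, rfl⟩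
    have hGD : (G, D) ∈ biSunGeneratorGraph hτ hT := by
      change ((G : circDual 𝕜 τ), (D : circDual 𝕜 τ)) ∈ circGeneratorGraph hτ hT
      rw [hG, hD]
      exact circIntegral_mem_circGeneratorGraph hτ hT f t
    have hfψ : (f : StrongDual 𝕜 X) (T t x - x) = ψ G := by
      rw [← hψ _ hGD, canonicalMap_apply, hD, map_sub]
      rfl
    have hGn : ‖G‖ ≤ K * t * ‖f‖ := by
      change ‖(G : circDual 𝕜 τ)‖ ≤ _
      rw [hG]
      exact norm_circIntegral_le hτ hT f fun s hs => hK s (hs.trans ht)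
    rw [hfψ]
    calc ‖ψ G‖ ≤ ‖ψ‖ * ‖G‖ := ψ.le_opNorm G
      _ ≤ ‖ψ‖ * (K * t * ‖f‖) := by gcongr
      _ = ‖ψ‖ * K * t * ‖f‖ := by ring
  calc _ ≤ ‖ψ‖ * K * t * L := h
    _ = ‖ψ‖ * K * L * t := by ring
    _ ≤ _ := by gcongr; exact Real.le_coe_toNNReal _

end BiCont

theorem mainTheorem8 {𝕜 X : Type*} [RCLike 𝕜] [NormedAddCommGroup X] [NormedSpace 𝕜 X]
    [CompleteSpace X] (τ : BiCont.AuxTopology X)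
    (hτ : BiCont.IsAdmissible 𝕜 τ) (hdual : BiCont.IsDualAdmissible 𝕜 τ)
    (hMazur : BiCont.IsMazur 𝕜 (BiCont.mixedTopology 𝕜 τ))
    (T : ℝ≥0 → X →L[𝕜] X) (hT : BiCont.IsBiContinuousSemigroup τ T) :
    Function.Injective (BiCont.canonicalMap hτ hT) ∧
    BiCont.canonicalMap hτ hT '' BiCont.favardSpace T =
      BiCont.adjointDomain (BiCont.biSunGeneratorGraph hτ hT) ∩
        BiCont.canonicalMap hτ hT '' BiCont.strongContSpace T ∧
    BiCont.canonicalMap hτ hT '' BiCont.favardSpace T =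
      BiCont.adjointDomain (BiCont.biSunGeneratorGraph hτ hT) ∩
        Set.range (BiCont.canonicalMap hτ hT) := by
  refine ⟨BiCont.canonicalMap_injective hτ hT, ?_, ?_⟩
  · ext φ
    constructor
    · rintro ⟨x, hx, rfl⟩
      exact ⟨BiCont.canonicalMap_mem_adjointDomain hτ hT hx, x,
        BiCont.favardSpace_subset_strongContSpace hx, rfl⟩
    · rintro ⟨hφ, x, -, rfl⟩
      exact ⟨x, BiCont.mem_favardSpace_of_canonicalMap_mem hτ hT hφ, rfl⟩
  · ext φ
    constructor
    · rintro ⟨x, hx, rfl⟩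
      exact ⟨BiCont.canonicalMap_mem_adjointDomain hτ hT hx, x, rfl⟩
    · rintro ⟨hφ, x, rfl⟩
      exact ⟨x, BiCont.mem_favardSpace_of_canonicalMap_mem hτ hT hφ, rfl⟩
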